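/- For an integer $n\ge 0$ let $b_{13}(n)$ denote the number of $13$-regular partitions of $n$, that is, partitions of $n$ none of whose parts is divisible by $13$ (so $b_{13}(0)=1$), and set $b_{13}(n)=0$ for $n<0$. Let $\alpha,n\ge 0$ be integers and let $p_1,\dots,p_{\alpha+1}$ be odd primes (not necessarily distinct) such that $b_{13}\left(\frac{p_i-1}{2}\right)\equiv 0\pmod{13}$ for every $1\le i\le \alpha+1$. Then for every integer $j\not\equiv 0\pmod{p_{\alpha+1}}$, \[ b_{13}\left(p_1^2\cdots p_{\alpha+1}^2\,n+\frac{p_1^2\cdots p_\alpha^2\,p_{\alpha+1}(2j+p_{\alpha+1})-1}{2}\right)\equiv 0\pmod{13}. \] -/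

import Mathlib

/-- The number `b_ℓ(n)` of `ℓ`-regular partitions of the integer `n`, i.e. partitions of `n` none
of whose parts is divisible by `ℓ`; it is `0` for `n < 0`. -/
def regularPartitionCount (ℓ : ℕ) (n : ℤ) : ℕ :=
  if n < 0 then 0 else (Nat.Partition.restricted n.toNat (fun i => ¬ ℓ ∣ i)).card

/-! Modulo a prime `ℓ`, the generating function of the `ℓ`-regular partitions is the `(ℓ - 1)`-st
power of the Euler product, by Glaisher's theorem and
`1 + x + ⋯ + x ^ (ℓ - 1) ≡ (1 - x) ^ (ℓ - 1)`. For `ℓ = 13` this says that `b₁₃(n)` is congruent to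
the coefficient `a(2n + 1)` of `η ^ 12`, expanded in powers of `exp (π i z)`.

The form `η ^ 12` has weight `6` and transforms under `SL(2, ℤ)` by the sign character of
`SL(2, ZMod 2) ≅ S₃`. If `g` is bounded at infinity and has the same weight and character, then
`η ^ 12 * g` is a cusp form of weight `12` and level one, hence a multiple of `Δ = η ^ 24`; so `g`
is a multiple of `η ^ 12`. Applied to the twisted Hecke operators, this gives
`a(pn) + p ^ 5 a(n / p) = a(p) a(n)` for odd primes `p`. If `13` divides `a(p)`, it therefore
divides `a(pn)` whenever `p ∤ n`, and `a(p ^ 2 n)` whenever it divides `a(n)`.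
-/

section HeckeOperator

open FixedDetMatrices MatrixGroups ModularForm Matrix.SpecialLinearGroup
open UpperHalfPlane hiding I
open scoped Manifold

theorem exists_smul_eq_reduce {m : ℤ} (A : FixedDetMatrix (Fin 2) ℤ m) :
    ∃ γ : SL(2, ℤ), reduce A = γ • A := by
  induction A using reduce_rec with
  | base A hA =>
    by_cases hpos : 0 < A.1 0 0
    · exact ⟨_, reduce_of_pos hA hpos⟩
    · exact ⟨ModularGroup.T ^ (-(-A.1 0 1 / -A.1 1 1)) * (ModularGroup.S * ModularGroup.S), by
        rw [reduce_of_not_pos hA hpos, mul_smul, mul_smul]⟩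
  | step A hA ih =>
    obtain ⟨γ, hγ⟩ := ih
    exact ⟨γ * (ModularGroup.S * ModularGroup.T ^ (-(A.1 0 0 / A.1 1 0))), by
      rw [← reduce_reduceStep hA, hγ, mul_smul, mul_smul, reduceStep]⟩

theorem eq_of_mem_reps_of_smul_eq {m : ℤ} {A B : FixedDetMatrix (Fin 2) ℤ m} {γ : SL(2, ℤ)}
    (hA : A ∈ reps m) (hB : B ∈ reps m) (h : γ • A = B) : A = B := by
  obtain ⟨hA₁₀, hA₀₀, hA₀₁, hA₁₁⟩ := hA
  obtain ⟨hB₁₀, hB₀₀, hB₀₁, hB₁₁⟩ := hB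
  have entry (i j) : B.1 i j = γ i 0 * A.1 0 j + γ i 1 * A.1 1 j := by
    rw [← h, smul_coe, Matrix.mul_apply, Fin.sum_univ_two]
  have hγ₁₀ : γ 1 0 = 0 := by simpa [entry, hA₁₀, hA₀₀.ne'] using hB₁₀
  have hγ₀₀ : 0 < γ 0 0 := by simpa [entry, hA₁₀, hA₀₀] using hB₀₀
  have hdet : γ 0 0 * γ 1 1 = 1 := by
    simpa only [Matrix.det_fin_two, hγ₁₀, mul_zero, sub_zero] using γ.det_coe
  have hγ₀₀' : γ 0 0 = 1 := Int.eq_one_of_mul_eq_one_right hγ₀₀.le hdet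
  have hγ₁₁ : γ 1 1 = 1 := by simpa [hγ₀₀'] using hdet
  have hB₀₁_eq : B.1 0 1 = A.1 0 1 + γ 0 1 * A.1 1 1 := by simp [entry 0 1, hγ₀₀']
  have hB₁₁_eq : B.1 1 1 = A.1 1 1 := by simp [entry 1 1, hγ₁₀, hγ₁₁]
  have hdvd : A.1 1 1 ∣ B.1 0 1 - A.1 0 1 := ⟨γ 0 1, by rw [hB₀₁_eq]; ring⟩
  have hsub : B.1 0 1 - A.1 0 1 = 0 := by
    refine Int.eq_zero_of_abs_lt_dvd ((abs_dvd _ _).2 hdvd) ?_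
    rw [hB₁₁_eq, abs_of_nonneg hB₀₁] at hB₁₁
    rw [abs_of_nonneg hA₀₁] at hA₁₁
    exact abs_sub_lt_of_nonneg_of_lt hB₀₁ hB₁₁ hA₀₁ hA₁₁
  have hγ₀₁ : γ 0 1 * A.1 1 1 = 0 := by linarith
  ext i j
  fin_cases i <;> fin_cases j <;> simp [entry, hA₁₀, hγ₁₀, hγ₀₀', hγ₁₁, hγ₀₁]

variable {m : ℕ}

/-- The right action of `SL(2, ℤ)` on integral matrices of determinant `m`, by multiplication. -/
def mulRight (A : FixedDetMatrix (Fin 2) ℤ m) (γ : SL(2, ℤ)) : FixedDetMatrix (Fin 2) ℤ m :=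
  ⟨A.1 * γ, by rw [Matrix.det_mul, A.2, γ.det_coe, mul_one]⟩

theorem smul_mulRight (γ δ : SL(2, ℤ)) (A : FixedDetMatrix (Fin 2) ℤ m) :
    γ • mulRight A δ = mulRight (γ • A) δ :=
  FixedDetMatrices.ext' _ _ (mul_assoc _ _ _).symm

theorem mulRight_injective (γ : SL(2, ℤ)) :
    Function.Injective fun A : FixedDetMatrix (Fin 2) ℤ m ↦ mulRight A γ := fun A B h ↦ by
  have h' : A.1 * (γ : Matrix (Fin 2) (Fin 2) ℤ) = B.1 * γ := congrArg Subtype.val h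
  have hγ : IsUnit (γ : Matrix (Fin 2) (Fin 2) ℤ) :=
    (Matrix.isUnit_iff_isUnit_det _).2 (by rw [γ.det_coe]; exact isUnit_one)
  exact FixedDetMatrices.ext' _ _ (hγ.mul_left_inj.1 h')

variable [NeZero m]

/-- The permutation of the representatives of `SL(2, ℤ) \ FixedDetMatrix (Fin 2) ℤ m` induced by
right multiplication by `γ`. -/
noncomputable def repsPerm (γ : SL(2, ℤ)) : Equiv.Perm (reps (m : ℤ)) :=
  Equiv.ofBijective
    (fun A ↦ ⟨reduce (mulRight A.1 γ), reduce_mem_reps (NeZero.ne _) _⟩) <| by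
      refine Function.Injective.bijective_of_finite fun A B h ↦ Subtype.ext ?_
      obtain ⟨δ, hδ⟩ := exists_smul_eq_reduce (mulRight A.1 γ)
      obtain ⟨ε, hε⟩ := exists_smul_eq_reduce (mulRight B.1 γ)
      have hAB : mulRight (δ • A.1) γ = mulRight (ε • B.1) γ := by
        rw [← smul_mulRight, ← smul_mulRight, ← hδ, ← hε]
        exact congrArg Subtype.val h
      refine eq_of_mem_reps_of_smul_eq (γ := ε⁻¹ * δ) A.2 B.2 ?_
      rw [mul_smul, mulRight_injective γ hAB, inv_smul_smul]

/-- An integral matrix of positive determinant as an element of `GL(2, ℝ)`. -/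
noncomputable def fixedDetToGL (A : FixedDetMatrix (Fin 2) ℤ m) : GL (Fin 2) ℝ :=
  .mkOfDetNeZero ((Int.castRingHom ℝ).mapMatrix A.1) <| by
    rw [← RingHom.map_det, A.2, map_natCast]
    exact NeZero.ne _

theorem det_fixedDetToGL (A : FixedDetMatrix (Fin 2) ℤ m) : (fixedDetToGL A).det.val = m := by
  have h := (Int.castRingHom ℝ).map_det A.1
  rw [A.2, map_natCast] at h
  exact h.symm

theorem fixedDetToGL_smul (γ : SL(2, ℤ)) (A : FixedDetMatrix (Fin 2) ℤ m) :
    fixedDetToGL (γ • A) = (γ : GL (Fin 2) ℝ) * fixedDetToGL A :=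
  Units.ext (map_mul _ _ _)

theorem fixedDetToGL_mulRight (A : FixedDetMatrix (Fin 2) ℤ m) (γ : SL(2, ℤ)) :
    fixedDetToGL (mulRight A γ) = fixedDetToGL A * (γ : GL (Fin 2) ℝ) :=
  Units.ext (map_mul _ _ _)

/-- `f` transforms under the weight `k` action of `SL(2, ℤ)` by the inverse of `χ`. The character
is defined on all integral matrices so that it can twist the sum defining a Hecke operator. -/
def IsQuasiInvariant (χ : Matrix (Fin 2) (Fin 2) ℤ →* ℂ) (k : ℤ) (f : ℍ → ℂ) : Prop :=
  ∀ γ : SL(2, ℤ), χ γ • f ∣[k] γ = f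

/-- The Hecke operator of index `m` on functions of weight `k` twisted by `χ`, summed over
representatives of `SL(2, ℤ) \ FixedDetMatrix (Fin 2) ℤ m`. -/
noncomputable def heckeOperator (χ : Matrix (Fin 2) (Fin 2) ℤ →* ℂ) (k : ℤ) (m : ℕ) [NeZero m]
    (f : ℍ → ℂ) : ℍ → ℂ :=
  ∑ A : reps (m : ℤ), χ A.1.1 • f ∣[k] fixedDetToGL A.1

variable {χ : Matrix (Fin 2) (Fin 2) ℤ →* ℂ} {k : ℤ} {f : ℍ → ℂ}

theorem smul_slash_of_pos {g : GL (Fin 2) ℝ} (hg : 0 < g.det.val) (c : ℂ) :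
    (c • f) ∣[k] g = c • f ∣[k] g := by
  rw [ModularForm.smul_slash, σ, if_pos hg]; rfl

theorem IsQuasiInvariant.smul_slash_fixedDetToGL_smul (hf : IsQuasiInvariant χ k f) (γ : SL(2, ℤ))
    (A : FixedDetMatrix (Fin 2) ℤ m) :
    χ (γ • A).1 • f ∣[k] fixedDetToGL (γ • A) = χ A.1 • f ∣[k] fixedDetToGL A := by
  have hdet : 0 < (fixedDetToGL A).det.val := by
    rw [det_fixedDetToGL]; exact_mod_cast NeZero.pos m
  conv_rhs => rw [← hf γ, smul_slash_of_pos hdet]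
  rw [fixedDetToGL_smul, SlashAction.slash_mul, smul_coe, map_mul, mul_comm, mul_smul]
  rfl

theorem IsQuasiInvariant.smul_slash_fixedDetToGL_reduce (hf : IsQuasiInvariant χ k f)
    (A : FixedDetMatrix (Fin 2) ℤ m) :
    χ (reduce A).1 • f ∣[k] fixedDetToGL (reduce A) = χ A.1 • f ∣[k] fixedDetToGL A := by
  obtain ⟨γ, hγ⟩ := exists_smul_eq_reduce A
  rw [hγ, hf.smul_slash_fixedDetToGL_smul]

theorem IsQuasiInvariant.heckeOperator (hf : IsQuasiInvariant χ k f) :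
    IsQuasiInvariant χ k (heckeOperator χ k m f) := fun γ ↦ by
  calc χ γ • _root_.heckeOperator χ k m f ∣[k] γ
      = ∑ A : reps (m : ℤ), χ (mulRight A.1 γ).1 • f ∣[k] fixedDetToGL (mulRight A.1 γ) := by
        rw [_root_.heckeOperator, SlashAction.sum_slash, Finset.smul_sum]
        refine Finset.sum_congr rfl fun A _ ↦ ?_
        rw [SL_smul_slash, smul_smul, fixedDetToGL_mulRight, SlashAction.slash_mul, mul_comm,
          ← map_mul]
        rfl
    _ = ∑ A : reps (m : ℤ), χ (repsPerm γ A).1.1 • f ∣[k] fixedDetToGL (repsPerm γ A).1 :=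
        Finset.sum_congr rfl fun A _ ↦ (hf.smul_slash_fixedDetToGL_reduce _).symm
    _ = _ := Equiv.sum_comp (repsPerm γ)
        fun A : reps (m : ℤ) ↦ χ A.1.1 • f ∣[k] fixedDetToGL A.1

theorem mdifferentiable_heckeOperator (hf : MDiff f) : MDiff (heckeOperator χ k m f) :=
  MDifferentiable.sum fun _ _ ↦ (hf.slash k _).const_smul _

theorem isBoundedAtImInfty_heckeOperator (hf : IsBoundedAtImInfty f) :
    IsBoundedAtImInfty (heckeOperator χ k m f) :=
  Submodule.sum_mem (Filter.boundedFilterSubmodule ℂ atImInfty) fun A _ ↦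
    Submodule.smul_mem _ _ (hf.slash k (by simp [fixedDetToGL, A.2.1]))

end HeckeOperator

section EtaTwelve

open ModularForm MatrixGroups Filter Complex Function.Periodic
open UpperHalfPlane hiding I
open scoped Real Topology Manifold

variable {χ : Matrix (Fin 2) (Fin 2) ℤ →* ℂ} {k l : ℤ} {f g : ℍ → ℂ}

theorem isQuasiInvariant_of_generators (hS : χ ModularGroup.S • f ∣[k] ModularGroup.S = f)
    (hT : χ ModularGroup.T • f ∣[k] ModularGroup.T = f) : IsQuasiInvariant χ k f := fun γ ↦ by
  have hγ : γ ∈ Subgroup.closure {ModularGroup.S, ModularGroup.T} := by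
    simp only [SpecialLinearGroup.SL2Z_generators, Subgroup.mem_top]
  induction hγ using Subgroup.closure_induction with
  | mem γ hγ => rcases hγ with rfl | rfl <;> assumption
  | one => simp
  | mul γ δ _ _ hγ hδ =>
    rw [SlashAction.slash_mul, Matrix.SpecialLinearGroup.coe_mul, map_mul, mul_comm, mul_smul,
      ← SL_smul_slash, hγ, hδ]
  | inv γ _ hγ =>
    conv_lhs => rw [← hγ]
    rw [SL_smul_slash, ← SlashAction.slash_mul, mul_inv_cancel, SlashAction.slash_one, smul_smul,
      ← map_mul, ← Matrix.SpecialLinearGroup.coe_mul, inv_mul_cancel,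
      Matrix.SpecialLinearGroup.coe_one, map_one, one_smul]

theorem IsQuasiInvariant.mul_slash (hf : IsQuasiInvariant χ k f) (hg : IsQuasiInvariant χ l g)
    (hχ : ∀ γ : SL(2, ℤ), χ γ * χ γ = 1) (γ : SL(2, ℤ)) : (f * g) ∣[k + l] γ = f * g := by
  conv_rhs => rw [← hf γ, ← hg γ, smul_mul_smul_comm, hχ, one_smul]
  exact mul_slash_SL2 k l γ f g

/-- The multiplicative function on `2 × 2` matrices over `ZMod 2` which vanishes on singular
matrices and is the sign character on the invertible ones, a group isomorphic to `S₃`. -/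
def zmodTwoSign : Matrix (Fin 2) (Fin 2) (ZMod 2) →* ℤ where
  toFun M := if M.det = 0 then 0 else if M * M = 1 ∧ M ≠ 1 then -1 else 1
  map_one' := by decide
  map_mul' := by decide

/-- The sign character of integral matrices modulo two. -/
def modTwoSign : Matrix (Fin 2) (Fin 2) ℤ →* ℂ :=
  (Int.castRingHom ℂ : ℤ →* ℂ).comp
    (zmodTwoSign.comp (Int.castRingHom (ZMod 2)).mapMatrix.toMonoidHom)

theorem modTwoSign_apply (A : Matrix (Fin 2) (Fin 2) ℤ) :
    modTwoSign A = zmodTwoSign (A.map Int.cast) := rfl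

theorem modTwoSign_S : modTwoSign ModularGroup.S = -1 := by
  rw [modTwoSign_apply, show zmodTwoSign _ = -1 by decide]; norm_num

theorem modTwoSign_T : modTwoSign ModularGroup.T = -1 := by
  rw [modTwoSign_apply, show zmodTwoSign _ = -1 by decide]; norm_num

theorem modTwoSign_mul_self (γ : SL(2, ℤ)) : modTwoSign γ * modTwoSign γ = 1 := by
  have key : ∀ M : Matrix (Fin 2) (Fin 2) (ZMod 2), M.det = 1 →
      zmodTwoSign M * zmodTwoSign M = 1 := by decide
  have hdet : (γ.1.map (Int.cast : ℤ → ZMod 2)).det = 1 := by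
    simpa [γ.2] using ((Int.castRingHom (ZMod 2)).map_det γ.1).symm
  rw [modTwoSign_apply]
  exact_mod_cast key _ hdet

theorem qParam_pow_eq_qParam {h h' : ℝ} {z w : ℂ} {n : ℕ} (hzw : n * z / h = w / h') :
    qParam h z ^ n = qParam h' w := by
  rw [qParam, qParam, ← exp_nat_mul]
  congr 1
  linear_combination 2 * π * I * hzw

/-- The weight six form `η ^ 12` on the upper half-plane. -/
noncomputable def etaTwelve (z : ℍ) : ℂ := η z ^ 12

theorem etaTwelve_ne_zero (z : ℍ) : etaTwelve z ≠ 0 := pow_ne_zero _ (eta_ne_zero z.2)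

theorem etaTwelve_eq (z : ℍ) :
    etaTwelve z = qParam 2 z * (∏' n : ℕ, (1 - qParam 1 z ^ (n + 1))) ^ 12 := by
  have hq : qParam 24 z ^ 12 = qParam 2 z := qParam_pow_eq_qParam (by push_cast; ring)
  rw [etaTwelve, ModularForm.eta, mul_pow, hq]

theorem etaTwelve_vadd_one (z : ℍ) : etaTwelve ((1 : ℝ) +ᵥ z) = -etaTwelve z := by
  have h₁ : qParam 1 ((1 : ℂ) + z) = qParam 1 z := by
    rw [qParam, qParam, ← exp_periodic (2 * π * I * z / (1 : ℝ))]
    congr 1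
    push_cast
    ring
  have h₂ : qParam 2 ((1 : ℂ) + z) = -qParam 2 z := by
    rw [qParam, qParam, ← exp_antiperiodic]
    congr 1
    push_cast
    ring
  rw [etaTwelve_eq, etaTwelve_eq, coe_vadd, ofReal_one, h₁, h₂, neg_mul]

theorem etaTwelve_S_smul (z : ℍ) : etaTwelve (ModularGroup.S • z) = -z ^ 6 * etaTwelve z := by
  have hη : η (-(z : ℂ)⁻¹) = (sqrt I)⁻¹ * (sqrt z * η z) := by
    simpa [neg_div] using eta_comp_eq_csqrt_I_inv z.2
  have hsqrt (w : ℂ) : sqrt w ^ 12 = w ^ 6 := by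
    rw [show 12 = 2 * 6 by rfl, pow_mul, Complex.sqrt]
    congr 1
    exact_mod_cast cpow_nat_inv_pow w two_ne_zero
  have hI : (I : ℂ) ^ 6 = -1 := by rw [show 6 = 2 + 4 by rfl, pow_add, I_sq, I_pow_four, mul_one]
  rw [etaTwelve, etaTwelve, modular_S_smul, coe_mk, inv_neg, hη, mul_pow, mul_pow, inv_pow, hsqrt,
    hsqrt, hI]
  ring

theorem isQuasiInvariant_etaTwelve : IsQuasiInvariant modTwoSign 6 etaTwelve := by
  refine isQuasiInvariant_of_generators ?_ ?_ <;> ext z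
  · have hz : (z : ℂ) ≠ 0 := z.ne_zero
    rw [Pi.smul_apply, modTwoSign_S, SL_slash_apply, etaTwelve_S_smul, ModularGroup.denom_S,
      zpow_neg, zpow_ofNat, smul_eq_mul]
    field_simp
  · rw [Pi.smul_apply, modTwoSign_T, SL_slash_apply, modular_T_smul, etaTwelve_vadd_one,
      ModularGroup.denom_apply]
    simp [ModularGroup.T]

theorem mdifferentiable_etaTwelve : MDiff etaTwelve := by
  rw [UpperHalfPlane.mdifferentiable_iff]
  exact DifferentiableOn.congr (f := fun z ↦ η z ^ 12)
    (fun z hz ↦ ((differentiableAt_eta_of_mem_upperHalfPlaneSet hz).pow 12).differentiableWithinAt)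
    fun z hz ↦ by rw [Function.comp_apply, etaTwelve, ofComplex_apply_of_im_pos hz]

theorem etaTwelve_mul_self : etaTwelve * etaTwelve = discriminant :=
  funext fun z ↦ (pow_add (η z) 12 12).symm

theorem isZeroAtImInfty_etaTwelve : IsZeroAtImInfty etaTwelve := by
  have h := (etaTwelve_mul_self ▸ discriminant_isZeroAtImInfty).norm.sqrt
  rw [IsZeroAtImInfty, ZeroAtFilter, tendsto_zero_iff_norm_tendsto_zero]
  simpa using h

/-- A weight `k` cusp form of level one, from invariance under `SL(2, ℤ)`. -/
def cuspFormOfSlashInvariant (hf : MDiff f) (hinv : ∀ γ : SL(2, ℤ), f ∣[k] γ = f)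
    (hzero : IsZeroAtImInfty f) : CuspForm 𝒮ℒ k where
  toFun := f
  slash_action_eq' := by rintro _ ⟨γ, rfl⟩; exact hinv γ
  holo' := hf
  zero_at_cusps' hc := by
    rw [Subgroup.IsArithmetic.isCusp_iff_isCusp_SL2Z] at hc
    exact (OnePoint.isZeroAt_iff_forall_SL2Z hc).2 fun γ _ ↦ (hinv γ).symm ▸ hzero

theorem exists_eq_smul_etaTwelve (hg : IsQuasiInvariant modTwoSign 6 g) (hdiff : MDiff g)
    (hbdd : IsBoundedAtImInfty g) : ∃ c : ℂ, g = c • etaTwelve := by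
  have hinv : ∀ γ : SL(2, ℤ), (etaTwelve * g) ∣[(12 : ℤ)] γ = etaTwelve * g := by
    rw [show (12 : ℤ) = 6 + 6 by rfl]
    exact isQuasiInvariant_etaTwelve.mul_slash hg modTwoSign_mul_self
  have hdiff' : MDiff (etaTwelve * g) := mdifferentiable_etaTwelve.mul hdiff
  have hzero : IsZeroAtImInfty (etaTwelve * g) :=
    ZeroAtFilter.mul_boundedAtFilter isZeroAtImInfty_etaTwelve hbdd
  obtain ⟨c, hc⟩ := CuspForm.exists_smul_discriminant_of_weight_eq_twelve
    (cuspFormOfSlashInvariant hdiff' hinv hzero)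
  have hmul : c • (etaTwelve * etaTwelve) = etaTwelve * g := by
    rw [etaTwelve_mul_self]
    exact congrArg DFunLike.coe hc
  refine ⟨c, funext fun z ↦ mul_left_cancel₀ (etaTwelve_ne_zero z) ?_⟩
  simpa [mul_left_comm] using (congrFun hmul z).symm

end EtaTwelve

section PrimeIndex

open FixedDetMatrices ModularForm Function.Periodic Complex
open UpperHalfPlane hiding I
open scoped Real

theorem sum_pow_mul_of_isPrimitiveRoot {R : Type*} [CommRing R] [IsDomain R] {ζ : R} {m : ℕ}
    (hζ : IsPrimitiveRoot ζ m) (n : ℕ) :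
    ∑ b : Fin m, ζ ^ (b * n : ℕ) = if m ∣ n then (m : R) else 0 := by
  rw [Fin.sum_univ_eq_sum_range fun b ↦ ζ ^ (b * n)]
  simp only [mul_comm _ n, pow_mul]
  split_ifs with h
  · simp [(hζ.pow_eq_one_iff_dvd n).2 h]
  · have hne : ζ ^ n ≠ 1 := mt (hζ.pow_eq_one_iff_dvd n).1 h
    refine eq_zero_of_ne_zero_of_mul_left_eq_zero (sub_ne_zero.2 hne) ?_
    rw [mul_geom_sum, ← pow_mul, mul_comm, pow_mul, hζ.pow_eq_one, one_pow, sub_self]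

theorem isPrimitiveRoot_neg_exp {m : ℕ} (hm : Odd m) :
    IsPrimitiveRoot (-exp (π * I / m)) m := by
  obtain ⟨r, rfl⟩ := hm
  have hcop : (r + 1).Coprime (2 * r + 1) := by
    rw [show 2 * r + 1 = r + (r + 1) by ring, Nat.coprime_add_self_right]
    simp
  have hexp : exp (2 * π * I / (2 * r + 1 : ℕ)) ^ (r + 1) = -exp (π * I / (2 * r + 1 : ℕ)) := by
    have hr : ((2 * r + 1 : ℕ) : ℂ) ≠ 0 := Nat.cast_ne_zero.2 (Nat.succ_ne_zero _)
    rw [← exp_antiperiodic, ← exp_nat_mul]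
    congr 1
    field_simp
    push_cast
    ring
  exact hexp ▸ (isPrimitiveRoot_exp (2 * r + 1) (Nat.succ_ne_zero _)).pow_of_coprime _ hcop

variable {m : ℕ}

/-- The representative of `SL(2, ℤ) \ FixedDetMatrix (Fin 2) ℤ m` acting by `z ↦ m z`. -/
def scaleRep (m : ℕ) : FixedDetMatrix (Fin 2) ℤ m := ⟨!![m, 0; 0, 1], by simp⟩

/-- The representative of `SL(2, ℤ) \ FixedDetMatrix (Fin 2) ℤ m` acting by `z ↦ (z + b) / m`. -/
def translateRep (m b : ℕ) : FixedDetMatrix (Fin 2) ℤ m := ⟨!![1, b; 0, m], by simp⟩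

theorem eq_scaleRep_or_translateRep {p : ℕ} (hp : p.Prime) {A : FixedDetMatrix (Fin 2) ℤ p}
    (hA : A ∈ reps (p : ℤ)) : A = scaleRep p ∨ ∃ b : Fin p, A = translateRep p b := by
  obtain ⟨h₁₀, h₀₀, h₀₁, h₁₁⟩ := hA
  have hdet : A.1 0 0 * A.1 1 1 = p := by
    simpa only [Matrix.det_fin_two, h₁₀, mul_zero, sub_zero] using A.2
  obtain ⟨a, ha⟩ := Int.eq_ofNat_of_zero_le h₀₀.le
  obtain ⟨b, hb⟩ := Int.eq_ofNat_of_zero_le h₀₁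
  have hdvd : a ∣ p := Int.natCast_dvd_natCast.1 ⟨A.1 1 1, by rw [← ha, hdet]⟩
  rcases (Nat.dvd_prime hp).1 hdvd with rfl | rfl
  · have hd : A.1 1 1 = p := by simpa [ha] using hdet
    refine .inr ⟨⟨b, by simpa [hb, hd] using h₁₁⟩, FixedDetMatrices.ext _ _ fun i j ↦ ?_⟩
    fin_cases i <;> fin_cases j <;> simp [translateRep, ha, hb, hd, h₁₀]
  · have hd : A.1 1 1 = 1 := by simpa [ha, hp.ne_zero] using hdet
    have hb' : A.1 0 1 = 0 := by simpa [hd] using h₁₁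
    refine .inl (FixedDetMatrices.ext _ _ fun i j ↦ ?_)
    fin_cases i <;> fin_cases j <;> simp [scaleRep, ha, hb', hd, h₁₀]

theorem sum_reps_prime {M : Type*} [AddCommMonoid M] {p : ℕ} (hp : p.Prime)
    (F : FixedDetMatrix (Fin 2) ℤ p → M) :
    ∑ A : reps (p : ℤ), F A = F (scaleRep p) + ∑ b : Fin p, F (translateRep p b) := by
  have hscale : scaleRep p ∈ reps (p : ℤ) := by
    refine ⟨rfl, ?_, le_rfl, ?_⟩ <;> simp [scaleRep, hp.pos]
  have htranslate (b : Fin p) : translateRep p b ∈ reps (p : ℤ) := by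
    refine ⟨rfl, ?_, ?_, ?_⟩ <;> simp [translateRep]
  let e : Option (Fin p) → reps (p : ℤ) := fun o ↦ o.elim ⟨_, hscale⟩ fun b ↦ ⟨_, htranslate b⟩
  have he : Function.Bijective e := by
    constructor
    · have hne (b : ℕ) : scaleRep p ≠ translateRep p b := fun h ↦ hp.ne_one <| by
        simpa [scaleRep, translateRep] using congrArg (fun A ↦ A.1 0 0) h
      have hinj (b c : Fin p) (h : translateRep p b = translateRep p c) : b = c := by
        simpa [translateRep, Fin.ext_iff] using congrArg (fun A ↦ A.1 0 1) h
      rintro (_ | b) (_ | c) h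
      · rfl
      · exact absurd (congrArg Subtype.val h) (hne c)
      · exact absurd (congrArg Subtype.val h).symm (hne b)
      · exact congrArg some (hinj b c (congrArg Subtype.val h))
    · rintro ⟨A, hA⟩
      rcases eq_scaleRep_or_translateRep hp hA with rfl | ⟨b, rfl⟩
      · exact ⟨none, rfl⟩
      · exact ⟨some b, rfl⟩
  rw [← he.sum_comp, Fintype.sum_option]
  rfl

theorem slash_fixedDetToGL_apply [NeZero m] (f : ℍ → ℂ) (k : ℤ) {A : FixedDetMatrix (Fin 2) ℤ m}
    (hA : A.1 1 0 = 0) {z w : ℍ} (hw : (w : ℂ) = (A.1 0 0 * z + A.1 0 1) / A.1 1 1) :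
    (f ∣[k] fixedDetToGL A) z = m ^ (k - 1) * (A.1 1 1 : ℂ) ^ (-k) * f w := by
  have hdet : 0 < (fixedDetToGL A).det.val := by
    rw [det_fixedDetToGL]; exact_mod_cast NeZero.pos m
  have hsmul : fixedDetToGL A • z = w := by
    ext
    rw [coe_smul_of_det_pos hdet, hw]
    simp [num, denom, fixedDetToGL, hA]
  rw [ModularForm.slash_apply, hsmul, σ, if_pos hdet, det_fixedDetToGL]
  simp [denom, fixedDetToGL, hA]
  ring

theorem modTwoSign_scaleRep (hm : Odd m) : modTwoSign (scaleRep m).1 = 1 := by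
  have hmap : (scaleRep m).1.map (Int.cast : ℤ → ZMod 2) = 1 := by
    ext i j
    fin_cases i <;> fin_cases j <;> simp [scaleRep, (ZMod.natCast_eq_one_iff_odd).2 hm]
  rw [modTwoSign_apply, hmap, map_one, Int.cast_one]

theorem modTwoSign_translateRep (hm : Odd m) (b : ℕ) :
    modTwoSign (translateRep m b).1 = (-1) ^ b := by
  have hmap : (translateRep m b).1.map (Int.cast : ℤ → ZMod 2) =
      !![1, (b : ZMod 2); 0, 1] := by
    ext i j
    fin_cases i <;> fin_cases j <;> simp [translateRep, (ZMod.natCast_eq_one_iff_odd).2 hm]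
  rw [modTwoSign_apply, hmap]
  rcases b.even_or_odd with hb | hb
  · rw [(ZMod.natCast_eq_zero_iff_even).2 hb, hb.neg_one_pow,
      show zmodTwoSign !![1, 0; 0, 1] = 1 by decide, Int.cast_one]
  · rw [(ZMod.natCast_eq_one_iff_odd).2 hb, hb.neg_one_pow,
      show zmodTwoSign !![1, 1; 0, 1] = -1 by decide, Int.cast_neg, Int.cast_one]

theorem qParam_two_add_div_pow (z : ℂ) {n : ℕ} (hn : Odd n) (b : ℕ) :
    (-1) ^ b * qParam 2 ((z + b) / m) ^ n =
      qParam 2 (z / m) ^ n * (-exp (π * I / m)) ^ (b * n) := by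
  have hq : qParam 2 ((z + b) / m) = qParam 2 (z / m) * exp (π * I / m) ^ b := by
    rw [qParam, qParam, ← exp_nat_mul, ← exp_add]
    congr 1
    push_cast
    ring
  have hsign : (-1 : ℂ) ^ (b * n) = (-1) ^ b := by rw [mul_comm, pow_mul, hn.neg_one_pow]
  rw [hq, neg_pow (exp _), hsign, pow_mul]
  ring

variable [NeZero m] {f : ℍ → ℂ} {a : ℕ → ℂ}

theorem hasSum_comp_mul_left_iff {M : Type*} [AddCommMonoid M] [TopologicalSpace M] {u : ℕ → M}
    {x : M} (hu : ∀ n, ¬ m ∣ n → u n = 0) : HasSum (fun n ↦ u (m * n)) x ↔ HasSum u x :=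
  (mul_right_injective₀ (NeZero.ne m)).hasSum_iff fun n hn ↦
    hu n fun ⟨l, hl⟩ ↦ hn ⟨l, hl.symm⟩

theorem slash_translateRep_apply (f : ℍ → ℂ) (k : ℤ) {b : ℕ} {z w : ℍ}
    (hw : (w : ℂ) = (z + b) / m) :
    (f ∣[k] fixedDetToGL (translateRep m b)) z = (m : ℂ)⁻¹ * f w := by
  have hpow : (m : ℂ) ^ (k - 1) * (m : ℂ) ^ (-k) = (m : ℂ)⁻¹ := by
    rw [← zpow_add₀ (NeZero.ne _), ← zpow_neg_one]
    congr 1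
    ring
  rw [slash_fixedDetToGL_apply f k (w := w) rfl (by simp [translateRep, hw]),
    show ((translateRep m b).1 1 1 : ℂ) = m by simp [translateRep], hpow]

theorem hasSum_slash_scaleRep (k : ℤ)
    (hf : ∀ z : ℍ, HasSum (fun n ↦ a n * qParam 2 z ^ n) (f z)) (z : ℍ) :
    HasSum (fun n ↦ m ^ (k - 1) * (if m ∣ n then a (n / m) else 0) * qParam 2 z ^ n)
      ((f ∣[k] fixedDetToGL (scaleRep m)) z) := by
  have hm : (0 : ℝ) < m := Nat.cast_pos.2 (NeZero.pos m)
  have hw : 0 < (m * z : ℂ).im := by simpa using mul_pos hm z.im_pos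
  have hq : qParam 2 (m * z : ℂ) = qParam 2 z ^ m := (qParam_pow_eq_qParam rfl).symm
  rw [slash_fixedDetToGL_apply f k (w := ⟨m * z, hw⟩) rfl (by simp [scaleRep]),
    ← hasSum_comp_mul_left_iff (m := m) fun n hn ↦ by simp [hn]]
  simpa [scaleRep, hq, pow_mul, NeZero.pos m, mul_assoc] using
    (hf ⟨m * z, hw⟩).mul_left ((m : ℂ) ^ (k - 1))

theorem hasSum_slash_translateRep (k : ℤ) (hm : Odd m) (ha : ∀ n, Even n → a n = 0)
    (hf : ∀ z : ℍ, HasSum (fun n ↦ a n * qParam 2 z ^ n) (f z)) (z : ℍ) :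
    HasSum (fun n ↦ a (m * n) * qParam 2 z ^ n)
      (∑ b : Fin m, (-1) ^ (b : ℕ) * (f ∣[k] fixedDetToGL (translateRep m b)) z) := by
  have hm₀ : (m : ℂ) ≠ 0 := NeZero.ne _
  have hw (b : ℕ) : 0 < ((z + b) / m : ℂ).im := by
    simpa using div_pos z.im_pos (Nat.cast_pos.2 (NeZero.pos m) : (0 : ℝ) < m)
  have hq : qParam 2 (z / m : ℂ) ^ m = qParam 2 z :=
    qParam_pow_eq_qParam (by rw [mul_div_cancel₀ _ hm₀])
  have hslash (b : ℕ) : (f ∣[k] fixedDetToGL (translateRep m b)) z =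
      (m : ℂ)⁻¹ * f ⟨(z + b) / m, hw b⟩ := slash_translateRep_apply f k rfl
  have hterm (n : ℕ) : ∑ b : Fin m, (-1) ^ (b : ℕ) * ((m : ℂ)⁻¹ *
      (a n * qParam 2 ((z + (b : ℕ)) / m) ^ n)) =
        if m ∣ n then a n * qParam 2 (z / m) ^ n else 0 := by
    rcases n.even_or_odd with hn | hn
    · simp [ha n hn]
    · -- For odd `n` the signs `(-1) ^ b` turn `exp (π i / m)` into a primitive root of unity.
      calc _ = (m : ℂ)⁻¹ * a n * qParam 2 (z / m) ^ n *
            ∑ b : Fin m, (-exp (π * I / m)) ^ (b * n : ℕ) := by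
            rw [Finset.mul_sum]
            refine Finset.sum_congr rfl fun b _ ↦ ?_
            linear_combination (m : ℂ)⁻¹ * a n * qParam_two_add_div_pow (m := m) z hn b
        _ = _ := by
            rw [sum_pow_mul_of_isPrimitiveRoot (isPrimitiveRoot_neg_exp hm)]
            split_ifs
            · field_simp
            · rw [mul_zero]
  have h := hasSum_sum (s := Finset.univ) fun (b : Fin m) _ ↦
    ((hf ⟨(z + (b : ℕ)) / m, hw b⟩).mul_left (m : ℂ)⁻¹).mul_left ((-1) ^ (b : ℕ))
  simp only [hterm, ← hslash] at h
  rw [← hasSum_comp_mul_left_iff (m := m) fun n hn ↦ if_neg hn] at h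
  simpa [pow_mul, hq] using h

theorem hasSum_heckeOperator_prime {p : ℕ} [NeZero p] (hp : p.Prime) (hodd : Odd p) (k : ℤ)
    (ha : ∀ n, Even n → a n = 0)
    (hf : ∀ z : ℍ, HasSum (fun n ↦ a n * qParam 2 z ^ n) (f z)) (z : ℍ) :
    HasSum (fun n ↦ (p ^ (k - 1) * (if p ∣ n then a (n / p) else 0) + a (p * n)) *
      qParam 2 z ^ n) (heckeOperator modTwoSign k p f z) := by
  have hsum : heckeOperator modTwoSign k p f z = (f ∣[k] fixedDetToGL (scaleRep p)) z +
      ∑ b : Fin p, (-1) ^ (b : ℕ) * (f ∣[k] fixedDetToGL (translateRep p b)) z := by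
    rw [heckeOperator, sum_reps_prime hp fun A ↦ modTwoSign A.1 • f ∣[k] fixedDetToGL A]
    simp only [Pi.add_apply, Finset.sum_apply, Pi.smul_apply, smul_eq_mul, one_mul,
      modTwoSign_scaleRep hodd, modTwoSign_translateRep hodd]
  simpa only [hsum, add_mul] using
    (hasSum_slash_scaleRep k hf z).add (hasSum_slash_translateRep k hodd ha hf z)

end PrimeIndex

section QExpansion

open Filter Metric PowerSeries PowerSeries.WithPiTopology UpperHalfPlane ModularForm
open scoped Topology Manifold

theorem qExpansion_unique {h : ℝ} (hh : 0 < h) {f : ℍ → ℂ} {a b : ℕ → ℂ}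
    (ha : ∀ z : ℍ, HasSum (fun n ↦ a n * Function.Periodic.qParam h z ^ n) (f z))
    (hb : ∀ z : ℍ, HasSum (fun n ↦ b n * Function.Periodic.qParam h z ^ n) (f z)) : a = b := by
  have hsub (z : ℍ) :
      HasSum (fun n ↦ (a n - b n) • Function.Periodic.qParam h z ^ n) ((0 : ℍ → ℂ) z) := by
    have hab := (ha z).sub (hb z)
    rw [sub_self] at hab
    exact hab.congr_fun fun n ↦ by rw [smul_eq_mul, sub_mul]
  have hanalytic : AnalyticAt ℂ (cuspFunction h (0 : ℍ → ℂ)) 0 :=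
    analyticAt_cuspFunction_zero hh (by simp [Function.Periodic]) mdifferentiable_const
      (isBoundedAtImInfty_of_hasSum_qExpansion hh hsub)
  have hseries (c : ℕ → ℂ)
      (hc : ∀ z : ℍ, HasSum (fun n ↦ c n • Function.Periodic.qParam h z ^ n) ((0 : ℍ → ℂ) z)) :=
    (hasFPowerSeriesOnBall_cuspFunction hh hanalytic hc).hasFPowerSeriesAt
  ext n
  have hcoeff := congrArg (FormalMultilinearSeries.coeff · n)
    ((hseries _ hsub).eq_formalMultilinearSeries (hseries 0 fun z ↦ by simp))
  simpa only [FormalMultilinearSeries.coeff_ofScalars, Pi.zero_apply, sub_eq_zero] using hcoeff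

theorem tendstoLocallyUniformlyOn_iteratedDeriv {E ι : Type*} [NormedAddCommGroup E]
    [NormedSpace ℂ E] [CompleteSpace E] {φ : Filter ι} {U : Set ℂ} {F : ι → ℂ → E} {f : ℂ → E}
    (hf : TendstoLocallyUniformlyOn F f φ U)
    (hF : ∀ i, DifferentiableOn ℂ (F i) U) (hU : IsOpen U) (k : ℕ) :
    TendstoLocallyUniformlyOn (fun i ↦ iteratedDeriv k (F i)) (iteratedDeriv k f) φ U := by
  induction k generalizing F f with
  | zero => simpa using hf
  | succ k ih =>
    simpa only [iteratedDeriv_succ', Function.comp_apply] using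
      ih (hf.deriv (.of_forall hF) hU) fun i ↦ (hF i).deriv hU

theorem iteratedDeriv_polynomial_eval {𝕜 : Type*} [NontriviallyNormedField 𝕜] (P : Polynomial 𝕜)
    (k : ℕ) :
    iteratedDeriv k (fun z ↦ P.eval z) = fun z ↦ (Polynomial.derivative^[k] P).eval z := by
  induction k generalizing P with
  | zero => simp
  | succ k ih =>
    have hderiv : deriv (fun z ↦ P.eval z) = fun z ↦ P.derivative.eval z :=
      funext fun _ ↦ P.deriv
    rw [iteratedDeriv_succ', hderiv, ih, Function.iterate_succ_apply]

theorem hasSum_of_tendstoLocallyUniformlyOn_polynomial {ι : Type*} {φ : Filter ι} [φ.NeBot]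
    {P : ι → Polynomial ℂ} {f : ℂ → ℂ} {a : ℕ → ℂ} {r : ℝ}
    (hf : TendstoLocallyUniformlyOn (fun i z ↦ (P i).eval z) f φ (ball 0 r))
    (ha : ∀ n, Tendsto (fun i ↦ (P i).coeff n) φ (𝓝 (a n))) {z : ℂ} (hz : z ∈ ball 0 r) :
    HasSum (fun n ↦ a n * z ^ n) (f z) := by
  have hP (i) : DifferentiableOn ℂ (fun z ↦ (P i).eval z) (ball 0 r) :=
    (P i).differentiable.differentiableOn
  have h0 : (0 : ℂ) ∈ ball 0 r := mem_ball_self (dist_nonneg.trans_lt hz)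
  have hcoeff (n : ℕ) : iteratedDeriv n f 0 = n.factorial * a n := by
    refine tendsto_nhds_unique ((tendstoLocallyUniformlyOn_iteratedDeriv hf hP isOpen_ball
      n).tendsto_at h0) (((ha n).const_mul _).congr fun i ↦ ?_)
    simp only [iteratedDeriv_polynomial_eval]
    rw [← Polynomial.coeff_zero_eq_eval_zero, Polynomial.coeff_iterate_derivative]
    simp [Nat.descFactorial_self]
  have hTaylor := Complex.hasSum_taylorSeries_on_ball
    (hf.differentiableOn (.of_forall hP) isOpen_ball) hz
  refine hTaylor.congr_fun fun n ↦ ?_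
  have hn : (n.factorial : ℂ) ≠ 0 := by exact_mod_cast n.factorial_ne_zero
  rw [hcoeff, sub_zero, smul_eq_mul, smul_eq_mul]
  field_simp

theorem hasSum_coeff_pentagonalSeries_pow (k : ℕ) {q : ℂ} (hq : ‖q‖ < 1) :
    HasSum (fun n ↦ (pentagonalSeries ℂ ^ k).coeff n * q ^ n)
      ((∏' n : ℕ, (1 - q ^ (n + 1))) ^ k) := by
  let P (s : Finset ℕ) : Polynomial ℂ := ∏ n ∈ s, (1 - Polynomial.X ^ (n + 1))
  have hP : TendstoLocallyUniformlyOn (fun s q ↦ (P s).eval q)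
      (fun q ↦ ∏' n : ℕ, (1 - q ^ (n + 1))) atTop (ball 0 1) := by
    simpa [P, Polynomial.eval_prod, hasProdLocallyUniformlyOn_iff_tendstoLocallyUniformlyOn]
      using multipliableLocallyUniformlyOn_one_sub_pow.hasProdLocallyUniformlyOn
  have hcont := differentiableOn_tprod_one_sub_pow.continuousOn
  have hPpow : TendstoLocallyUniformlyOn (fun s q ↦ (P s ^ k).eval q)
      (fun q ↦ (∏' n : ℕ, (1 - q ^ (n + 1))) ^ k) atTop (ball 0 1) := by
    induction k with
    | zero => simpa using (tendsto_const_nhds.tendstoUniformlyOn_const _).tendstoLocallyUniformlyOn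
    | succ k ih =>
      simpa only [pow_succ, Polynomial.eval_mul] using ih.fun_mul₀ hP (hcont.pow k) hcont
  refine hasSum_of_tendstoLocallyUniformlyOn_polynomial hPpow (fun n ↦ ?_)
    (mem_ball_zero_iff.2 hq)
  have hprod : Tendsto (fun s : Finset ℕ ↦ ∏ n ∈ s, (1 - X ^ (n + 1) : ℂ⟦X⟧)) atTop
      (𝓝 (pentagonalSeries ℂ)) := hasProd_one_sub_X_pow ℂ
  refine ((tendsto_iff_coeff_tendsto ℂ _ _ _).1 (hprod.pow k) n).congr fun s ↦ ?_
  have hPs : (P s : ℂ⟦X⟧) = ∏ n ∈ s, (1 - X ^ (n + 1)) := by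
    simp only [P, ← Polynomial.coeToPowerSeries.ringHom_apply, map_prod]
    simp
  rw [← hPs, ← Polynomial.coe_pow, Polynomial.coeff_coe]

end QExpansion

section RegularPartitions

open PowerSeries PowerSeries.WithPiTopology

theorem geom_sum_eq_one_sub_pow_of_charP {R : Type*} [CommRing R] [IsDomain R] (p : ℕ)
    [hp : Fact p.Prime] [CharP R p] {x : R} (hx : x ≠ 1) :
    ∑ i ∈ Finset.range p, x ^ i = (1 - x) ^ (p - 1) := by
  refine mul_right_cancel₀ (sub_ne_zero.2 hx.symm) ?_
  rw [geom_sum_mul_neg, ← pow_succ, Nat.sub_add_cancel hp.out.one_le, sub_pow_char, one_pow]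

theorem mk_card_restricted_not_dvd (R : Type*) [CommRing R] [IsDomain R] (p : ℕ) [hp : Fact p.Prime]
    [CharP R p] :
    PowerSeries.mk (fun n ↦ ((Nat.Partition.restricted n (¬ p ∣ ·)).card : R)) =
      pentagonalSeries R ^ (p - 1) := by
  let _ : TopologicalSpace R := ⊥
  have _ : DiscreteTopology R := ⟨rfl⟩
  have _ : CharP R⟦X⟧ p := charP_of_injective_algebraMap (R := R) C_injective p
  have hpow := (hasProd_one_sub_X_pow R).map (powMonoidHom (p - 1)) (continuous_pow _)
  have hcount := Nat.Partition.hasProd_powerSeriesMk_card_countRestricted R hp.out.pos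
  simp only [Nat.Partition.card_restricted_eq_card_countRestricted _ hp.out.pos]
  refine hcount.unique (hpow.congr_fun fun n ↦ ?_)
  have hX : (X ^ (n + 1) : R⟦X⟧) ≠ 1 := fun h ↦ by simpa using congrArg constantCoeff h
  simp only [pow_mul, geom_sum_eq_one_sub_pow_of_charP p hX, Function.comp_apply,
    powMonoidHom_apply]

theorem map_pentagonalSeries {R S : Type*} [CommRing R] [CommRing S] (φ : R →+* S) :
    PowerSeries.map φ (pentagonalSeries R) = pentagonalSeries S := by
  ext n
  by_cases hn : n ∈ Set.range pentagonal
  · obtain ⟨k, rfl⟩ := hn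
    simp
  · simp [coeff_pentagonalSeries_eq_zero _ hn]

end RegularPartitions

section EtaTwelveCoeff

open ModularForm PowerSeries Function.Periodic UpperHalfPlane

/-- The coefficient of `q ^ n` in the expansion of `η ^ 12` in powers of `q = exp (π i z)`.
Only odd exponents occur, and the coefficient of `q ^ (2 * n + 1)` is the coefficient of `X ^ n` in
the twelfth power of the Euler product `∏ (1 - X ^ n)`. -/
noncomputable def etaTwelveCoeff (n : ℕ) : ℤ :=
  if Odd n then (pentagonalSeries ℤ ^ 12).coeff (n / 2) else 0

theorem etaTwelveCoeff_two_mul_add_one (n : ℕ) :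
    etaTwelveCoeff (2 * n + 1) = (pentagonalSeries ℤ ^ 12).coeff n := by
  rw [etaTwelveCoeff, if_pos (odd_two_mul_add_one n), Nat.mul_add_div two_pos,
    Nat.div_eq_of_lt one_lt_two, add_zero]

theorem etaTwelveCoeff_one : etaTwelveCoeff 1 = 1 := by
  have h : (pentagonalSeries ℤ).coeff 0 = 1 := coeff_pentagonalSeries_pentagonal ℤ 0
  rw [← zero_add 1, ← mul_zero 2, etaTwelveCoeff_two_mul_add_one, coeff_zero_eq_constantCoeff_apply,
    map_pow, ← coeff_zero_eq_constantCoeff_apply, h, one_pow]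

theorem etaTwelveCoeff_of_even {n : ℕ} (hn : Even n) : etaTwelveCoeff n = 0 :=
  if_neg (Nat.not_odd_iff_even.2 hn)

theorem hasSum_etaTwelve (z : ℍ) :
    HasSum (fun n ↦ (etaTwelveCoeff n : ℂ) * qParam 2 z ^ n) (etaTwelve z) := by
  have hinj : Function.Injective fun n : ℕ ↦ 2 * n + 1 := fun a b h ↦ by simpa using h
  have hq : qParam 2 z ^ 2 = qParam 1 z := qParam_pow_eq_qParam (by push_cast; ring)
  refine (hinj.hasSum_iff fun n hn ↦ ?_).1 ?_
  · have heven : Even n := Nat.not_odd_iff_even.1 fun ⟨m, hm⟩ ↦ hn ⟨m, hm.symm⟩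
    rw [etaTwelveCoeff_of_even heven, Int.cast_zero, zero_mul]
  · have hnorm : ‖qParam 1 z‖ < 1 :=
      Function.Periodic.norm_qParam_lt_one one_pos z.im_pos
    have hsum := (hasSum_coeff_pentagonalSeries_pow 12 hnorm).mul_left (qParam 2 z)
    rw [← etaTwelve_eq] at hsum
    refine hsum.congr_fun fun n ↦ ?_
    rw [Function.comp_apply, etaTwelveCoeff_two_mul_add_one,
      ← map_pentagonalSeries (Int.castRingHom ℂ), ← map_pow, coeff_map, eq_intCast,
      pow_succ _ (2 * n), pow_mul, hq]
    ring

variable {p : ℕ}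

theorem etaTwelveCoeff_prime_mul (hp : p.Prime) (hodd : Odd p) (n : ℕ) :
    etaTwelveCoeff (p * n) + p ^ 5 * (if p ∣ n then etaTwelveCoeff (n / p) else 0) =
      etaTwelveCoeff p * etaTwelveCoeff n := by
  have : NeZero p := ⟨hp.ne_zero⟩
  obtain ⟨c, hc⟩ := exists_eq_smul_etaTwelve
    (isQuasiInvariant_etaTwelve.heckeOperator (m := p))
    (mdifferentiable_heckeOperator mdifferentiable_etaTwelve)
    (isBoundedAtImInfty_heckeOperator isZeroAtImInfty_etaTwelve.isBoundedAtImInfty)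
  have hcoeff := qExpansion_unique two_pos
    (hasSum_heckeOperator_prime hp hodd 6
      (fun n hn ↦ by rw [etaTwelveCoeff_of_even hn, Int.cast_zero]) hasSum_etaTwelve)
    (b := fun n ↦ c * etaTwelveCoeff n) fun z ↦ by
      simpa only [hc, Pi.smul_apply, smul_eq_mul, mul_assoc] using (hasSum_etaTwelve z).mul_left c
  have hc_eq : c = etaTwelveCoeff p := by
    simpa [etaTwelveCoeff_one, hp.ne_one] using (congrFun hcoeff 1).symm
  have h := congrFun hcoeff n
  rw [hc_eq, add_comm, show (6 - 1 : ℤ) = (5 : ℕ) from rfl, zpow_natCast] at h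
  exact_mod_cast h

theorem dvd_etaTwelveCoeff_prime_mul (hp : p.Prime) (hodd : Odd p) {d : ℤ}
    (hd : d ∣ etaTwelveCoeff p) {n : ℕ} (hn : ¬ p ∣ n) : d ∣ etaTwelveCoeff (p * n) := by
  have h := etaTwelveCoeff_prime_mul hp hodd n
  rw [if_neg hn, mul_zero, add_zero] at h
  exact h ▸ hd.mul_right _

theorem dvd_etaTwelveCoeff_prime_sq_mul (hp : p.Prime) (hodd : Odd p) {d : ℤ}
    (hd : d ∣ etaTwelveCoeff p) {n : ℕ} (hn : d ∣ etaTwelveCoeff n) :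
    d ∣ etaTwelveCoeff (p ^ 2 * n) := by
  have h := etaTwelveCoeff_prime_mul hp hodd (p * n)
  rw [if_pos (dvd_mul_right p n), Nat.mul_div_cancel_left _ hp.pos, ← mul_assoc, ← sq] at h
  exact (dvd_add_left (hn.mul_left _)).1 (h ▸ hd.mul_right _)

theorem dvd_etaTwelveCoeff_prod_sq_mul {ι : Type*} (s : Finset ι) {p : ι → ℕ}
    (hp : ∀ i ∈ s, (p i).Prime) (hodd : ∀ i ∈ s, Odd (p i)) {d : ℤ}
    (hd : ∀ i ∈ s, d ∣ etaTwelveCoeff (p i)) {n : ℕ} (hn : d ∣ etaTwelveCoeff n) :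
    d ∣ etaTwelveCoeff ((∏ i ∈ s, p i ^ 2) * n) := by
  induction s using Finset.cons_induction with
  | empty => simpa using hn
  | cons i s hi ih =>
    rw [Finset.forall_mem_cons] at hp hodd hd
    rw [Finset.prod_cons, mul_assoc]
    exact dvd_etaTwelveCoeff_prime_sq_mul hp.1 hodd.1 hd.1 (ih hp.2 hodd.2 hd.2)

end EtaTwelveCoeff

theorem natCast_regularPartitionCount (p : ℕ) [Fact p.Prime] (n : ℕ) :
    (regularPartitionCount p n : ZMod p) =
      ((PowerSeries.pentagonalSeries ℤ ^ (p - 1)).coeff n : ℤ) := by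
  have h := PowerSeries.ext_iff.1 (mk_card_restricted_not_dvd (ZMod p) p) n
  rw [PowerSeries.coeff_mk, ← map_pentagonalSeries (Int.castRingHom _), ← map_pow,
    PowerSeries.coeff_map] at h
  rwa [regularPartitionCount, if_neg (by simp), Int.toNat_natCast]

theorem thirteen_dvd_regularPartitionCount_natCast_iff (n : ℕ) :
    13 ∣ regularPartitionCount 13 n ↔ 13 ∣ etaTwelveCoeff (2 * n + 1) := by
  have : Fact (Nat.Prime 13) := ⟨by norm_num⟩
  rw [← ZMod.natCast_eq_zero_iff, natCast_regularPartitionCount, ZMod.intCast_zmod_eq_zero_iff_dvd,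
    etaTwelveCoeff_two_mul_add_one]
  rfl

theorem thirteen_dvd_etaTwelveCoeff_of_odd {m : ℕ} (hm : Odd m)
    (h : 13 ∣ regularPartitionCount 13 (((m : ℤ) - 1) / 2)) : 13 ∣ etaTwelveCoeff m := by
  obtain ⟨k, rfl⟩ := hm
  rw [← thirteen_dvd_regularPartitionCount_natCast_iff]
  convert h using 2
  push_cast
  omega

theorem thirteen_dvd_regularPartitionCount {n : ℤ}
    (h : 13 ∣ etaTwelveCoeff (2 * n + 1).natAbs) : 13 ∣ regularPartitionCount 13 n := by
  rcases lt_or_ge n 0 with hn | hn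
  · rw [regularPartitionCount, if_pos hn]
    exact dvd_zero _
  · lift n to ℕ using hn
    exact (thirteen_dvd_regularPartitionCount_natCast_iff n).2 h

theorem two_mul_half_add_one {P q : ℤ} (hP : Odd P) (hq : Odd q) (n j : ℤ) :
    2 * (P * q ^ 2 * n + (P * q * (2 * j + q) - 1) / 2) + 1 = P * (q * (2 * (q * n + j) + q)) := by
  have heven : 2 ∣ P * q * (2 * j + q) - 1 :=
    (((hP.mul hq).mul ((even_two_mul j).add_odd hq)).sub_odd odd_one).two_dvd
  linear_combination Int.mul_ediv_cancel' heven

theorem dvd_of_odd_of_dvd_two_mul_add_self {q n j : ℤ} (hq : Odd q)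
    (h : q ∣ 2 * (q * n + j) + q) : q ∣ j := by
  have hcoprime : IsCoprime q 2 := Int.isCoprime_two_right.2 hq
  exact (dvd_add_right (dvd_mul_right q n)).1
    (hcoprime.dvd_of_dvd_mul_left (dvd_add_self_right.1 h))

theorem theorem1p3 (α n : ℕ) (p : Fin (α + 1) → ℕ)
    (hp : ∀ i, (p i).Prime) (hodd : ∀ i, Odd (p i))
    (hb : ∀ i, regularPartitionCount 13 (((p i : ℤ) - 1) / 2) ≡ 0 [MOD 13])
    (j : ℤ) (hj : ¬ j ≡ 0 [ZMOD (p (Fin.last α) : ℤ)]) :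
    regularPartitionCount 13
      ((∏ i : Fin (α + 1), (p i : ℤ) ^ 2) * n +
        ((∏ i : Fin α, (p i.castSucc : ℤ) ^ 2) * (p (Fin.last α) : ℤ) *
          (2 * j + (p (Fin.last α) : ℤ)) - 1) / 2) ≡ 0 [MOD 13] := by
  simp only [Nat.modEq_zero_iff_dvd, Int.modEq_zero_iff_dvd] at hb hj ⊢
  have ha (i) : 13 ∣ etaTwelveCoeff (p i) := thirteen_dvd_etaTwelveCoeff_of_odd (hodd i) (hb i)
  set q := p (Fin.last α)
  set P := ∏ i : Fin α, p i.castSucc ^ 2 with hP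
  have hq_odd : Odd (q : ℤ) := mod_cast hodd (Fin.last α)
  have hP_odd : Odd (P : ℤ) := mod_cast
    Finset.prod_induction _ Odd (fun _ _ ↦ Odd.mul) odd_one fun i _ ↦ (hodd i.castSucc).pow
  have hP_cast : ∏ i : Fin α, (p i.castSucc : ℤ) ^ 2 = P := by simp only [hP]; push_cast; rfl
  have hq_dvd : ¬ q ∣ (2 * (q * n + j) + q : ℤ).natAbs := fun h ↦
    hj (dvd_of_odd_of_dvd_two_mul_add_self hq_odd (Int.natCast_dvd.2 h))
  apply thirteen_dvd_regularPartitionCount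
  rw [Fin.prod_univ_castSucc, hP_cast, two_mul_half_add_one hP_odd hq_odd, Int.natAbs_mul,
    Int.natAbs_mul, Int.natAbs_natCast, Int.natAbs_natCast]
  exact dvd_etaTwelveCoeff_prod_sq_mul _ (fun i _ ↦ hp i.castSucc) (fun i _ ↦ hodd i.castSucc)
    (fun i _ ↦ ha i.castSucc) (dvd_etaTwelveCoeff_prime_mul (hp _) (hodd _) (ha _) hq_dvd)
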